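/- Consider one-server quantum private information retrieval (QPIR) with prior entanglement. The server holds $f$ quantum messages on $\mathbb{C}^d$ in pure states $|\psi_1\rangle,\dots,|\psi_f\rangle$, the user holds an index $k\in\{1,\dots,f\}$, and server and user share in advance a maximally entangled state $\frac{1}{\sqrt D}\sum_{e}|e\rangle|e\rangle$ on $\mathbb{C}^D\otimes\mathbb{C}^D$, which counts as $\log_2 D$ ebits. After local preparations, in each of finitely many rounds the user sends a quantum system (query) to the server and the server sends back a quantum system (answer); after the last round the user outputs a state on $\mathbb{C}^d$. The user applies quantum channels, which may depend on $k$; the server applies unitaries (with ancillas) and projective measurements, stores the outcomes in its memory (on which its later operations may act again), and keeps all systems it does not send. The communication complexity is the sum of $\log_2$ of the dimensions of all systems sent in either direction. The protocol is a correct Q-QPIR protocol if, when both parties follow it, the output is exactly $|\psi_k\rangle\langle\psi_k|$ for all pure states $|\psi_1\rangle,\dots,|\psi_f\rangle$ and all $k$. It is secret in the all-round criterion under the honest-server model if, when both parties follow it, for all pure states $|\psi_1\rangle,\dots,|\psi_f\rangle$ and in every round, the state of all systems held by the server on receipt of the query is the same for all $k$. Let $\mathsf{m}=f\log_2 d$ be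 the total message size. Corollary 3. For every constant message size $d\ge 2$ there is a family of correct Q-QPIR protocols, one for each number $f$ of messages on $\mathbb{C}^d$, that are secret in the all-round criterion under the honest-server model, have communication complexity $O(\log\mathsf{m})$ and use $\Theta(\mathsf{m})$ ebits of prior entanglement, as $f\to\infty$ (the implied constants may depend on $d$). -/

import Mathlib

open scoped ComplexOrder

/-!
Finite-dimensional quantum systems are represented by finite types `α` (the Hilbert space is `ℂ^α`
with its computational basis); joint systems are product types; states are density matrices.
-/

namespace QPIR

/-- `Φ` applied to the right factor of a joint system `γ ⊗ α`, i.e. `id_γ ⊗ Φ`. -/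
def mapRight {α β : Type} (γ : Type) (Φ : Matrix α α ℂ →ₗ[ℂ] Matrix β β ℂ)
    (M : Matrix (γ × α) (γ × α) ℂ) : Matrix (γ × β) (γ × β) ℂ :=
  Matrix.of fun p q => Φ (Matrix.of fun a a' => M (p.1, a) (q.1, a')) p.2 q.2

/-- `Φ` applied to the left factor of a joint system `α ⊗ γ`, i.e. `Φ ⊗ id_γ`. -/
def mapLeft {α β : Type} (γ : Type) (Φ : Matrix α α ℂ →ₗ[ℂ] Matrix β β ℂ)
    (M : Matrix (α × γ) (α × γ) ℂ) : Matrix (β × γ) (β × γ) ℂ :=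
  Matrix.of fun p q => Φ (Matrix.of fun a a' => M (a, p.2) (a', q.2)) p.1 q.1

/-- A quantum channel from `ℂ^α` to `ℂ^β`: a completely positive trace-preserving linear map. -/
structure Channel (α β : Type) [Fintype α] [Fintype β] where
  /-- the underlying linear map on matrices -/
  toLin : Matrix α α ℂ →ₗ[ℂ] Matrix β β ℂ
  trace_preserving : ∀ M : Matrix α α ℂ, (toLin M).trace = M.trace
  completely_positive : ∀ (n : ℕ) (M : Matrix (Fin n × α) (Fin n × α) ℂ),
    M.PosSemidef → (mapRight (Fin n) toLin M).PosSemidef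

/-- Partial trace over the left factor. -/
def traceLeft {α β : Type} [Fintype α] (M : Matrix (α × β) (α × β) ℂ) : Matrix β β ℂ :=
  Matrix.of fun b b' => ∑ a, M (a, b) (a, b')

/-- Partial trace over the right factor. -/
def traceRight {α β : Type} [Fintype β] (M : Matrix (α × β) (α × β) ℂ) : Matrix α α ℂ :=
  Matrix.of fun a a' => ∑ b, M (a, b) (a', b)

/-- The density matrix `|v⟩⟨v|`. -/
def pureState {d : ℕ} (v : EuclideanSpace ℂ (Fin d)) : Matrix (Fin d) (Fin d) ℂ :=
  Matrix.of fun i j => v i * star (v j)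

/-- The product state `|ψ₁⟩⟨ψ₁| ⊗ ⋯ ⊗ |ψ_f⟩⟨ψ_f|` of the message systems. -/
def messageState {f d : ℕ} (ψ : Fin f → EuclideanSpace ℂ (Fin d)) :
    Matrix (Fin f → Fin d) (Fin f → Fin d) ℂ :=
  Matrix.of fun x y => ∏ l, pureState (ψ l) (x l) (y l)

/-- The density matrix of the maximally entangled state `|E|^(-1/2) ∑ₑ |e⟩|e⟩` on `ℂ^E ⊗ ℂ^E`. -/
noncomputable def maxEntangled (E : Type) [Fintype E] [DecidableEq E] : Matrix (E × E) (E × E) ℂ :=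
  Matrix.of fun p q => if p.1 = p.2 ∧ q.1 = q.2 then ((Fintype.card E : ℂ))⁻¹ else 0

/-- An operation of the server from `ℂ^α` to `ℂ^β`: an isometry (a unitary together with ancillas in
pure states), followed by a projective measurement whose outcome the server stores. Here
`mem : β → σ` selects the part of the output that stays in the server's memory, and the outcome is a
function of the content of that memory. Nothing is traced out. -/
structure ServerOp (α β σ : Type) [DecidableEq α] [Fintype β] (mem : β → σ) where
  V : Matrix β α ℂ
  isometry : V.conjTranspose * V = 1
  Outcome : Type
  [decidableEqOutcome : DecidableEq Outcome]
  outcome : σ → Outcome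

attribute [instance] ServerOp.decidableEqOutcome

/-- The action on density matrices: `M ↦ ∑ₒ Pₒ V M V† Pₒ`, where `Pₒ` is the projection onto the
basis states with outcome `o`. -/
def ServerOp.toLin {α β σ : Type} [DecidableEq α] [Fintype α] [Fintype β] {mem : β → σ}
    (O : ServerOp α β σ mem) : Matrix α α ℂ →ₗ[ℂ] Matrix β β ℂ where
  toFun M := Matrix.of fun p q =>
    if O.outcome (mem p) = O.outcome (mem q) then (O.V * M * O.V.conjTranspose) p q else 0
  map_add' M N := by
    ext p q
    by_cases h : O.outcome (mem p) = O.outcome (mem q) <;> simp [h, Matrix.mul_add, Matrix.add_mul]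
  map_smul' c M := by
    ext p q
    by_cases h : O.outcome (mem p) = O.outcome (mem q) <;> simp [h]

/-- A one-server QPIR protocol for `f` messages on `ℂ^d`, with prior entanglement.

Server and user share a maximally entangled state on `ℂ^E ⊗ ℂ^E`; the server also holds the `f`
message systems and the user knows the index `k` of the wanted message.
The user applies arbitrary channels, which may depend on `k`. The server applies unitaries and
projective measurements, stores the outcomes in its memory (on which later operations may act), and
traces out nothing.
Before the interaction both parties may act locally (`serverPrep`, `userPrep`). In round `i + 1`
(`i < rounds`) the user turns the last answer `A i` and the memory `T i` into a query `Q i`, which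
is sent to the server, and a memory `T (i + 1)`; the server turns its memory `S i` and the query
into a memory `S (i + 1)` and an answer `A (i + 1)`, which is sent to the user. After the last round
the user decodes. (`A 0` is local to the user. Data with `i` beyond `rounds` are never used.) -/
structure Protocol (f d : ℕ) where
  rounds : ℕ
  /-- one half of the prior entanglement -/
  E : Type
  /-- queries -/
  Q : ℕ → Type
  /-- answers -/
  A : ℕ → Type
  /-- local systems of the server -/
  S : ℕ → Type
  /-- local systems of the user -/
  T : ℕ → Type
  [fintypeE : Fintype E]
  [decidableEqE : DecidableEq E]
  [nonemptyE : Nonempty E]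
  [fintypeQ : ∀ i, Fintype (Q i)]
  [fintypeA : ∀ i, Fintype (A i)]
  [fintypeS : ∀ i, Fintype (S i)]
  [fintypeT : ∀ i, Fintype (T i)]
  [decidableEqQ : ∀ i, DecidableEq (Q i)]
  [decidableEqS : ∀ i, DecidableEq (S i)]
  serverPrep : ServerOp ((Fin f → Fin d) × E) (S 0) (S 0) id
  userPrep : Fin f → Channel E (A 0 × T 0)
  userOp : Fin f → (i : ℕ) → Channel (A i × T i) (Q i × T (i + 1))
  serverOp : (i : ℕ) → ServerOp (S i × Q i) (S (i + 1) × A (i + 1)) (S (i + 1)) Prod.fst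
  decode : Fin f → Channel (A rounds × T rounds) (Fin d)

namespace Protocol

attribute [instance] fintypeE decidableEqE nonemptyE fintypeQ fintypeA fintypeS fintypeT
  decidableEqQ decidableEqS

variable {f d : ℕ} (Φ : Protocol f d)

/-- The initial joint state of the server (messages and half of the entanglement) and the user. -/
noncomputable def initialState (ψ : Fin f → EuclideanSpace ℂ (Fin d)) :
    Matrix (((Fin f → Fin d) × Φ.E) × Φ.E) (((Fin f → Fin d) × Φ.E) × Φ.E) ℂ :=
  Matrix.of fun p q =>
    messageState ψ p.1.1 q.1.1 * maxEntangled Φ.E (p.1.2, p.2) (q.1.2, q.2)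

/-- One query: the joint state just after the server has received it, from the one before. -/
def queryStep (k : Fin f) (i : ℕ)
    (M : Matrix (Φ.S i × (Φ.A i × Φ.T i)) (Φ.S i × (Φ.A i × Φ.T i)) ℂ) :
    Matrix ((Φ.S i × Φ.Q i) × Φ.T (i + 1)) ((Φ.S i × Φ.Q i) × Φ.T (i + 1)) ℂ :=
  Matrix.reindex (Equiv.prodAssoc _ _ _).symm (Equiv.prodAssoc _ _ _).symm
    (mapRight (Φ.S i) (Φ.userOp k i).toLin M)

/-- One answer: the joint state just after the user has received it, from the one before. -/
def answerStep (i : ℕ)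
    (M : Matrix ((Φ.S i × Φ.Q i) × Φ.T (i + 1)) ((Φ.S i × Φ.Q i) × Φ.T (i + 1)) ℂ) :
    Matrix (Φ.S (i + 1) × (Φ.A (i + 1) × Φ.T (i + 1)))
      (Φ.S (i + 1) × (Φ.A (i + 1) × Φ.T (i + 1))) ℂ :=
  Matrix.reindex (Equiv.prodAssoc _ _ _) (Equiv.prodAssoc _ _ _)
    (mapLeft (Φ.T (i + 1)) (Φ.serverOp i).toLin M)

/-- The joint state of server and user after `i` rounds, both being honest, for message states `ψ`
and user's choice `k`. -/
noncomputable def stateAfter (ψ : Fin f → EuclideanSpace ℂ (Fin d)) (k : Fin f) :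
    (i : ℕ) → Matrix (Φ.S i × (Φ.A i × Φ.T i)) (Φ.S i × (Φ.A i × Φ.T i)) ℂ
  | 0 => mapRight (Φ.S 0) (Φ.userPrep k).toLin
      (mapLeft Φ.E Φ.serverPrep.toLin (Φ.initialState ψ))
  | i + 1 => Φ.answerStep i (Φ.queryStep k i (stateAfter ψ k i))

/-- The state of the server (its local system and the query just received) when it receives the
query of round `i + 1`. -/
noncomputable def serverState (ψ : Fin f → EuclideanSpace ℂ (Fin d)) (k : Fin f) (i : ℕ) :
    Matrix (Φ.S i × Φ.Q i) (Φ.S i × Φ.Q i) ℂ :=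
  traceRight (Φ.queryStep k i (Φ.stateAfter ψ k i))

/-- The output state of the protocol. -/
noncomputable def output (ψ : Fin f → EuclideanSpace ℂ (Fin d)) (k : Fin f) : Matrix (Fin d) (Fin d) ℂ :=
  (Φ.decode k).toLin (traceLeft (Φ.stateAfter ψ k Φ.rounds))

/-- Correctness for quantum messages: for all pure message states, the user obtains exactly the
state of the wanted message. -/
def IsCorrect : Prop :=
  ∀ ψ : Fin f → EuclideanSpace ℂ (Fin d), (∀ l, ‖ψ l‖ = 1) →
    ∀ k, Φ.output ψ k = pureState (ψ k)

/-- Secrecy in the all-round criterion under the honest-server model, with all pure states as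
inputs: in every round, the state of the server on receipt of the query is the same for all
choices of the user. -/
def IsAllRoundSecret : Prop :=
  ∀ ψ : Fin f → EuclideanSpace ℂ (Fin d), (∀ l, ‖ψ l‖ = 1) →
    ∀ i < Φ.rounds, ∀ k k', Φ.serverState ψ k i = Φ.serverState ψ k' i

/-- Upload complexity, in qubits. -/
noncomputable def uploadComplexity : ℝ :=
  ∑ i ∈ Finset.range Φ.rounds, Real.logb 2 (Fintype.card (Φ.Q i))

/-- Download complexity, in qubits. -/
noncomputable def downloadComplexity : ℝ :=
  ∑ i ∈ Finset.range Φ.rounds, Real.logb 2 (Fintype.card (Φ.A (i + 1)))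

/-- Communication complexity, in qubits. -/
noncomputable def communicationComplexity : ℝ :=
  Φ.uploadComplexity + Φ.downloadComplexity

/-- The amount of prior entanglement, in ebits: a maximally entangled state of local dimension `D`
counts as `log₂ D` ebits. -/
noncomputable def ebits : ℝ := Real.logb 2 (Fintype.card Φ.E)

end Protocol

/-- The total size of `f` messages on `ℂ^d`, in qubits. -/
noncomputable def messageSize (f d : ℕ) : ℝ := f * Real.logb 2 d

end QPIR

namespace QPIR

/-! Teleportation reduces the task to retrieving one classical label. The server teleports all
messages through the shared entanglement at once; the user then holds every message, the `l`-th
encrypted by a Weyl operator whose label the server knows, and needs only the label of message `k`.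

To hide `k`, the labels are stored in cyclic order shifted by a uniform `s`. The server moves `s`
out of its memory into the first answer and keeps no copy; the user adds `k` to the received
register and sends it back. The server thus sees `s + k` without `s`, a uniform position, and
answers with the label found there, which is that of message `k`. Only positions and single labels
travel, at logarithmic cost, while the entanglement has the size of the messages.

After the server's measurement every joint state is a sum of blocks indexed by the server's
registers and the register in transit (`classicalQuantum`). Secrecy is `traceRight_query`: `k`
enters only through the encrypted state in each block, which has trace one. Correctness is
`decode_cipher`: every block decodes to the wanted message. -/

/-! ### Channels in Kraus form and maps of basis states -/

/-- The linear map `M ↦ ∑ᵢ Kᵢ M Kᵢ†`. -/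
def krausMap {α β ι : Type} [Fintype α] [Fintype ι] (K : ι → Matrix β α ℂ) :
    Matrix α α ℂ →ₗ[ℂ] Matrix β β ℂ where
  toFun M := ∑ i, K i * M * (K i).conjTranspose
  map_add' M N := by simp [Matrix.mul_add, Matrix.add_mul, Finset.sum_add_distrib]
  map_smul' c M := by simp [Finset.smul_sum]

-- Extending by an identity keeps the Kraus form, which gives complete positivity of
-- `Channel.ofKraus`.
open scoped Kronecker in
theorem mapRight_krausMap {α β γ ι : Type} [Fintype α] [Fintype γ] [DecidableEq γ] [Fintype ι]
    (K : ι → Matrix β α ℂ) (M : Matrix (γ × α) (γ × α) ℂ) :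
    mapRight γ (krausMap K) M = ∑ i, ((1 : Matrix γ γ ℂ) ⊗ₖ K i) * M *
      ((1 : Matrix γ γ ℂ) ⊗ₖ K i).conjTranspose := by
  ext ⟨p, b⟩ ⟨q, b'⟩
  simp [mapRight, krausMap, Matrix.sum_apply, Matrix.mul_apply, Fintype.sum_prod_type,
    Matrix.one_apply, ite_mul, apply_ite, Finset.sum_ite_irrel]

/-- The channel with Kraus operators `Kᵢ`. -/
def Channel.ofKraus {α β ι : Type} [Fintype α] [Fintype β] [Fintype ι] [DecidableEq α]
    (K : ι → Matrix β α ℂ) (hK : ∑ i, (K i).conjTranspose * K i = 1) : Channel α β where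
  toLin := krausMap K
  trace_preserving M := by
    change (∑ i, K i * M * (K i).conjTranspose).trace = M.trace
    rw [Matrix.trace_sum]
    simp_rw [fun i => Matrix.trace_mul_cycle (K i) M (K i).conjTranspose]
    rw [← Matrix.trace_sum, ← Finset.sum_mul, hK, one_mul]
  completely_positive n M hM := by
    rw [mapRight_krausMap]
    exact Matrix.posSemidef_sum _ fun i _ => hM.mul_mul_conjTranspose_same _

theorem Channel.ofKraus_toLin_apply {α β ι : Type} [Fintype α] [Fintype β] [Fintype ι]
    [DecidableEq α] (K : ι → Matrix β α ℂ) (hK : ∑ i, (K i).conjTranspose * K i = 1)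
    (M : Matrix α α ℂ) (b b' : β) :
    (Channel.ofKraus K hK).toLin M b b' =
      ∑ i, ∑ a, ∑ a', K i b a * M a a' * star (K i b' a') := by
  change (∑ i, K i * M * (K i).conjTranspose) b b' = _
  simp only [Matrix.sum_apply, Matrix.mul_apply, Matrix.conjTranspose_apply, Finset.sum_mul]
  exact Finset.sum_congr rfl fun i _ => Finset.sum_comm

/-- The channel that maps the basis state `a` to `g a` and discards the register `z a`. -/
def Channel.relabel {α β ζ : Type} [Fintype α] [Fintype β] [Fintype ζ] [DecidableEq α]
    [DecidableEq β] [DecidableEq ζ] (g : α → β) (z : α → ζ)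
    (h : Function.Injective fun a => (g a, z a)) : Channel α β :=
  Channel.ofKraus (fun c => Matrix.of fun b a => if b = g a ∧ z a = c then (1 : ℂ) else 0) (by
    ext a a'
    simp only [Matrix.sum_apply, Matrix.mul_apply, Matrix.conjTranspose_apply, Matrix.of_apply,
      apply_ite star, star_one, star_zero, ite_mul, one_mul, zero_mul, ite_and,
      Finset.sum_ite_eq', Finset.sum_ite_eq, Finset.mem_univ, if_true, Matrix.one_apply]
    rw [← ite_and]
    refine if_congr ⟨fun ⟨h1, h2⟩ => ?_, fun e => ?_⟩ rfl rfl
    · exact h (Prod.ext h1 h2.symm)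
    · subst e; simp)

/-- Coherence between two basis states survives only if the discarded register agrees on them. -/
theorem Channel.relabel_toLin_apply {α β ζ : Type} [Fintype α] [Fintype β] [Fintype ζ]
    [DecidableEq α] [DecidableEq β] [DecidableEq ζ] (g : α → β) (z : α → ζ)
    (h : Function.Injective fun a => (g a, z a)) (M : Matrix α α ℂ) (b b' : β) :
    (Channel.relabel g z h).toLin M b b' =
      ∑ a, ∑ a', if b = g a ∧ b' = g a' ∧ z a = z a' then M a a' else 0 := by
  rw [Channel.relabel, Channel.ofKraus_toLin_apply, Finset.sum_comm]
  refine Finset.sum_congr rfl fun a _ => ?_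
  rw [Finset.sum_comm]
  refine Finset.sum_congr rfl fun a' _ => ?_
  simp only [Matrix.of_apply]
  rw [Finset.sum_eq_single (z a)]
  · by_cases h1 : b = g a <;> by_cases h2 : b' = g a' <;> by_cases h3 : z a = z a' <;>
      simp [h1, h2, h3, eq_comm]
  · intro c _ hc
    simp [hc.symm]
  · simp

/-- The server operation that maps the basis state `a` to `g a`, without any measurement. -/
def ServerOp.ofInjective {α β σ : Type} [Fintype α] [Fintype β] [DecidableEq α] [DecidableEq β]
    (mem : β → σ) (g : α → β) (hg : Function.Injective g) : ServerOp α β σ mem where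
  V := Matrix.of fun b a => if b = g a then 1 else 0
  isometry := by
    ext a a'
    simp [Matrix.mul_apply, Matrix.one_apply, hg.eq_iff]
    exact if_congr eq_comm rfl rfl
  Outcome := Unit
  outcome _ := ()

theorem ServerOp.ofInjective_toLin_apply {α β σ : Type} [Fintype α] [Fintype β] [DecidableEq α]
    [DecidableEq β] (mem : β → σ) (g : α → β) (hg : Function.Injective g) (M : Matrix α α ℂ)
    (b b' : β) : (ServerOp.ofInjective mem g hg).toLin M b b' =
      ∑ a, ∑ a', if b = g a ∧ b' = g a' then M a a' else 0 := by
  rw [Finset.sum_comm]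
  simp [ServerOp.toLin, ServerOp.ofInjective, Matrix.mul_apply, ite_and, apply_ite]
  refine Finset.sum_congr rfl fun a _ => ?_
  by_cases h : b' = g a <;> simp [h]

/-! ### Weyl operators -/

/-- The generalized Pauli operator `X^q Z^p` with label `(p, q)`. -/
noncomputable def weyl {d : ℕ} [NeZero d] (u : ZMod d × Fin d) : Matrix (Fin d) (Fin d) ℂ :=
  Matrix.of fun e x => if e = x + u.2 then ZMod.stdAddChar (u.1 * ((x : ℕ) : ZMod d)) else 0

theorem stdAddChar_mul_star {d : ℕ} [NeZero d] (a b : ZMod d) :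
    (ZMod.stdAddChar a : ℂ) * star (ZMod.stdAddChar b : ℂ) = ZMod.stdAddChar (a - b) := by
  rw [sub_eq_add_neg, AddChar.map_add_eq_mul, AddChar.map_neg_eq_conj]
  rfl

theorem weyl_unitary {d : ℕ} [NeZero d] (u : ZMod d × Fin d) :
    (weyl u).conjTranspose * weyl u = 1 := by
  ext x x'
  simp only [weyl, Matrix.mul_apply, Matrix.conjTranspose_apply, Matrix.of_apply, Matrix.one_apply,
    apply_ite star, star_zero, ite_mul, zero_mul, mul_ite, mul_zero,
    Finset.sum_ite_eq', Finset.mem_univ, if_true, add_left_inj]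
  by_cases h : x = x'
  · subst h
    rw [if_pos rfl, if_pos rfl, mul_comm, stdAddChar_mul_star, sub_self, AddChar.map_zero_eq_one]
  · rw [if_neg h, if_neg (Ne.symm h)]

/-- The `d²` Weyl operators form an orthogonal basis of the matrices, each of squared norm `d`; this
is the dual relation. The sum over the phase label is a character sum that forces `x = x'`. -/
theorem weyl_complete {d : ℕ} [NeZero d] (e x e' x' : Fin d) :
    ∑ u : ZMod d × Fin d, star (weyl u e x) * weyl u e' x' =
      if e = e' ∧ x = x' then (d : ℂ) else 0 := by
  have hcast : (((x' : ℕ) : ZMod d) - ((x : ℕ) : ZMod d) = 0) ↔ x = x' := by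
    rw [sub_eq_zero, ZMod.natCast_eq_natCast_iff', Nat.mod_eq_of_lt x.2, Nat.mod_eq_of_lt x'.2,
      Fin.ext_iff, eq_comm]
  have hsum : ∑ p : ZMod d, star (ZMod.stdAddChar (p * ((x : ℕ) : ZMod d)) : ℂ) *
      ZMod.stdAddChar (p * ((x' : ℕ) : ZMod d)) = if x = x' then (d : ℂ) else 0 := by
    simp_rw [mul_comm (star _), stdAddChar_mul_star, ← mul_sub]
    rw [AddChar.sum_mulShift _ (ZMod.isPrimitive_stdAddChar d)]
    simp [hcast, ZMod.card]
  rw [Fintype.sum_prod_type, Finset.sum_comm]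
  -- Only the shift that carries `x` to `e` has a nonzero entry there.
  rw [Finset.sum_eq_single (e - x)]
  · simp only [weyl, Matrix.of_apply, add_sub_cancel, if_true]
    by_cases hx : x = x'
    · subst hx
      by_cases he : e' = e
      · subst he
        simpa using hsum
      · simp [he, Ne.symm he]
    · by_cases he : e' = x' + (e - x)
      · simpa [he, hx] using hsum
      · simp [he, hx]
  · intro q _ hq
    have : e ≠ x + q := fun h => hq (by rw [h]; abel)
    simp [weyl, this]
  · simp

/-- A sum over two functions of a product of local terms factorizes. -/
theorem sum_sum_prod {ι κ κ' : Type} [Fintype ι] [DecidableEq ι] [Fintype κ] [Fintype κ']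
    (h : ι → κ → κ' → ℂ) :
    ∑ e : ι → κ, ∑ e' : ι → κ', ∏ l, h l (e l) (e' l) = ∏ l, ∑ a, ∑ b, h l a b := by
  rw [Fintype.prod_sum]
  simp_rw [Fintype.prod_sum]


/-! ### States with a classical register -/

/-- The joint state `∑ₓ |x⟩⟨x| ⊗ G x` of a classical register and a quantum system. -/
def classicalQuantum {X τ : Type} [DecidableEq X] (G : X → Matrix τ τ ℂ) :
    Matrix (X × τ) (X × τ) ℂ :=
  Matrix.of fun p q => if p.1 = q.1 then G p.1 p.2 q.2 else 0

theorem mapLeft_ofInjective_classicalQuantum {X Y τ σ : Type} [Fintype X] [Fintype Y]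
    [DecidableEq X] [DecidableEq Y] (mem : Y → σ) (g : X → Y) (hg : Function.Injective g)
    (G : X → Matrix τ τ ℂ) :
    mapLeft τ (ServerOp.ofInjective mem g hg).toLin (classicalQuantum G) =
      classicalQuantum fun y => ∑ x, if y = g x then G x else 0 := by
  ext ⟨y, e⟩ ⟨y', e'⟩
  simp only [mapLeft, Matrix.of_apply, ServerOp.ofInjective_toLin_apply, classicalQuantum]
  by_cases h : y = y'
  · subst h
    rw [if_pos rfl, Matrix.sum_apply]
    refine Finset.sum_congr rfl fun x _ => ?_
    rw [Finset.sum_eq_single x]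
    · by_cases hx : y = g x <;> simp [hx]
    · intro x' _ hx'
      simp [hx'.symm]
    · simp
  · rw [if_neg h]
    refine Finset.sum_eq_zero fun x _ => Finset.sum_eq_zero fun x' _ => ?_
    split_ifs with h1 h2
    · exact absurd (h1.1.trans (by rw [h2, h1.2])) h
    all_goals rfl

/-- As the register `A` is classical, discarding `z` destroys no coherence: the blocks with the same
new label simply add up. -/
theorem mapRight_relabel_classicalQuantum {X A Q ζ τ : Type} [Fintype X] [Fintype A] [Fintype Q]
    [Fintype ζ] [Fintype τ] [DecidableEq X] [DecidableEq A] [DecidableEq Q] [DecidableEq ζ]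
    [DecidableEq τ] (r : A → Q) (z : A → ζ)
    (h : Function.Injective fun a : A × τ => ((r a.1, a.2), z a.1))
    (G : X × A → Matrix τ τ ℂ) :
    Matrix.reindex (Equiv.prodAssoc X Q τ).symm (Equiv.prodAssoc X Q τ).symm
      (mapRight X (Channel.relabel (fun a : A × τ => (r a.1, a.2)) (fun a => z a.1) h).toLin
        (Matrix.reindex (Equiv.prodAssoc X A τ) (Equiv.prodAssoc X A τ) (classicalQuantum G))) =
      classicalQuantum fun y => ∑ a, if y.2 = r a then G (y.1, a) else 0 := by
  ext ⟨⟨x, q⟩, e⟩ ⟨⟨x', q'⟩, e'⟩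
  simp only [mapRight, Matrix.reindex_apply, Matrix.submatrix_apply, Matrix.of_apply,
    Equiv.symm_symm, Equiv.prodAssoc_apply, Equiv.prodAssoc_symm_apply,
    Channel.relabel_toLin_apply, classicalQuantum, Fintype.sum_prod_type, Prod.mk.injEq]
  by_cases hx : x = x'
  · subst hx
    have : ∀ a : A, (∑ t : τ, ∑ a' : A, ∑ t' : τ,
        if (q = r a ∧ e = t) ∧ (q' = r a' ∧ e' = t') ∧ z a = z a' then
          (if x = x ∧ a = a' then G (x, a) t t' else 0) else 0) =
        if q = r a ∧ q' = r a then G (x, a) e e' else 0 := by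
      intro a
      rw [Finset.sum_eq_single e, Finset.sum_eq_single a, Finset.sum_eq_single e']
      · simp
      · intro t _ ht; simp [ht.symm]
      · simp
      · intro a' _ ha; simp [ha.symm]
      · simp
      · intro t _ ht; simp [ht.symm]
      · simp
    refine (Finset.sum_congr rfl fun a _ => (this a)).trans ?_
    by_cases hq : q = q'
    · subst hq
      rw [if_pos ⟨rfl, rfl⟩, Matrix.sum_apply]
      exact Finset.sum_congr rfl fun a _ => by by_cases hq : q = r a <;> simp [hq]
    · simp only [hq, and_false, if_false]
      refine Finset.sum_eq_zero fun a _ => if_neg fun h => hq (h.1.trans h.2.symm)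
  · simp [hx]

section Protocol

variable {f d : ℕ} [NeZero f] [NeZero d]

/-! ### The protocol -/

/-- The isometry that teleports every message through its share of the entanglement, prepares a
uniform rotation `s`, and stores the label of the `l`-th correction at position `l + s`. -/
noncomputable def teleport (f d : ℕ) [NeZero f] [NeZero d] :
    Matrix ((Fin f → ZMod d × Fin d) × Fin f) ((Fin f → Fin d) × (Fin f → Fin d)) ℂ :=
  Matrix.of fun p a =>
    ((√((f : ℝ) * (d : ℝ) ^ f) : ℝ) : ℂ)⁻¹ * ∏ l, weyl (p.1 (l + p.2)) (a.2 l) (a.1 l)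

theorem star_mul_self_normalization (f d : ℕ) :
    star (((√((f : ℝ) * (d : ℝ) ^ f) : ℝ) : ℂ)⁻¹) * ((√((f : ℝ) * (d : ℝ) ^ f) : ℝ) : ℂ)⁻¹ =
      ((f : ℂ) * (d : ℂ) ^ f)⁻¹ := by
  have h : (0 : ℝ) ≤ (f : ℝ) * (d : ℝ) ^ f := by positivity
  rw [← Complex.ofReal_inv, ← starRingEnd_apply, Complex.conj_ofReal, ← Complex.ofReal_mul,
    ← mul_inv, Real.mul_self_sqrt h]
  push_cast
  rfl

/-- For fixed `s`, `weyl_complete` at each of the `f` sites gives `d ^ f`; the `f` rotations give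
the remaining factor of the normalization. -/
theorem teleport_isometry : (teleport f d).conjTranspose * teleport f d = 1 := by
  ext ⟨x, e⟩ ⟨x', e'⟩
  have hs : ∀ s : Fin f, ∑ m : Fin f → ZMod d × Fin d,
      ∏ l, star (weyl (m (l + s)) (e l) (x l)) * weyl (m (l + s)) (e' l) (x' l) =
      if (x, e) = (x', e') then (d : ℂ) ^ f else 0 := by
    intro s
    -- Summing over all label assignments absorbs the rotation.
    rw [Fintype.sum_equiv ((Equiv.addRight s).symm.arrowCongr (Equiv.refl _)) _
      (fun m : Fin f → ZMod d × Fin d =>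
        ∏ l, star (weyl (m l) (e l) (x l)) * weyl (m l) (e' l) (x' l)) (by intro m; simp)]
    rw [← Fintype.prod_sum (fun l u => star (weyl u (e l) (x l)) * weyl u (e' l) (x' l))]
    simp_rw [weyl_complete]
    split_ifs with h
    · obtain ⟨rfl, rfl⟩ := Prod.mk.inj h
      simp
    · obtain ⟨l, hl⟩ : ∃ l, ¬ (e l = e' l ∧ x l = x' l) := by
        by_contra! hc
        exact h (Prod.ext (funext fun l => (hc l).2) (funext fun l => (hc l).1))
      exact Finset.prod_eq_zero (Finset.mem_univ l) (if_neg hl)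
  have hf : (f : ℂ) ≠ 0 := Nat.cast_ne_zero.2 (NeZero.ne f)
  have hd : (d : ℂ) ≠ 0 := Nat.cast_ne_zero.2 (NeZero.ne d)
  simp only [Matrix.mul_apply, Matrix.conjTranspose_apply, teleport, Matrix.of_apply, star_mul',
    star_prod, mul_mul_mul_comm, star_mul_self_normalization, ← Finset.prod_mul_distrib,
    ← Finset.mul_sum]
  rw [Fintype.sum_prod_type, Finset.sum_comm]
  simp_rw [hs]
  rw [Matrix.one_apply]
  split_ifs
  · simp only [Finset.sum_const, Finset.card_univ, Fintype.card_fin, nsmul_eq_mul]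
    field_simp
  · simp

/-- The Kraus operator of the decoding step: undo the correction on the `k`-th register, with the
answer and the other registers discarded. -/
noncomputable def decodeKraus (k : Fin f) (c : (Fin f × (ZMod d × Fin d)) × (Fin f → Fin d)) :
    Matrix (Fin d) ((Fin f × (ZMod d × Fin d)) × (Fin f → Fin d)) ℂ :=
  Matrix.of fun x a =>
    if a.1 = c.1 ∧ Function.update a.2 k 0 = c.2 then star (weyl a.1.2 (a.2 k) x) else 0

theorem weyl_mul_conjTranspose (u : ZMod d × Fin d) : weyl u * (weyl u).conjTranspose = 1 :=
  mul_eq_one_comm.mp (weyl_unitary u)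

/-- The index `c` records everything discarded, so each basis state meets a single `c`, and the
claim reduces to unitarity of one Weyl operator. -/
theorem decodeKraus_sum {f d : ℕ} [NeZero d] (k : Fin f) :
    ∑ c, (decodeKraus (d := d) k c).conjTranspose * decodeKraus k c = 1 := by
  ext ⟨a, e⟩ ⟨a', e'⟩
  simp only [Matrix.sum_apply, Matrix.mul_apply, Matrix.conjTranspose_apply, decodeKraus,
    Matrix.of_apply]
  rw [Finset.sum_eq_single (a, Function.update e k 0)]
  · by_cases h : a' = a ∧ Function.update e' k 0 = Function.update e k 0
    · obtain ⟨rfl, h⟩ := h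
      have hw := congrFun (congrFun (weyl_mul_conjTranspose a'.2) (e k)) (e' k)
      simp only [Matrix.mul_apply, Matrix.conjTranspose_apply] at hw
      simp only [h, and_self, if_true, star_star, hw, Matrix.one_apply, Prod.mk.injEq, true_and]
      refine if_congr ⟨fun hk => funext fun l => ?_, fun h => by rw [h]⟩ rfl rfl
      by_cases hl : l = k
      · rw [hl, hk]
      · simpa [hl] using (congrFun h l).symm
    · have : (a, e) ≠ (a', e') := by
        rintro h'
        obtain ⟨rfl, rfl⟩ := Prod.mk.inj h'
        exact h ⟨rfl, rfl⟩
      simp [h, this]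
  · intro c _ hc
    have : ¬ (a = c.1 ∧ Function.update e k 0 = c.2) := fun h => hc (Prod.ext h.1.symm h.2.symm)
    simp [this]
  · simp

/-- The server's memory: a correction label for each position, and a position. -/
abbrev Memory (f d : ℕ) : Type := (Fin f → ZMod d × Fin d) × Fin f

/-- The answers: a position and a correction label. -/
abbrev Answer (f d : ℕ) : Type := Fin f × (ZMod d × Fin d)

/-- The user's half of the prior entanglement. -/
abbrev Share (f d : ℕ) : Type := Fin f → Fin d

/-- The server teleports all messages and measures its whole memory. -/
noncomputable def teleportOp (f d : ℕ) [NeZero f] [NeZero d] :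
    ServerOp (Share f d × Share f d) (Memory f d) (Memory f d) id where
  V := teleport f d
  isometry := teleport_isometry
  Outcome := Memory f d
  outcome := id

theorem prep_injective {f d : ℕ} [NeZero f] [NeZero d] (k : Fin f) :
    Function.Injective
    fun e : Share f d => ((((-k, 0), e), ()) : (Answer f d × Share f d) × Unit) :=
  fun e e' h => by simpa using h

/-- Before the interaction the user prepares the position `-k`. -/
def prepChannel (d : ℕ) [NeZero d] (k : Fin f) : Channel (Share f d) (Answer f d × Share f d) :=
  Channel.relabel (fun e => ((-k, 0), e)) (fun _ => ()) (prep_injective k)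

/-- The user returns the received position, shifted by `k`. -/
def queryChannel (d : ℕ) [NeZero d] (k : Fin f) :
    Channel (Answer f d × Share f d) (Fin f × Share f d) :=
  Channel.relabel (fun a => (a.1.1 + k, a.2)) (fun a => a.1.2) fun a a' h => by
    simp only [Prod.mk.injEq, add_left_inj] at h
    exact Prod.ext (Prod.ext h.1.1 h.2) h.1.2

/-- The server sends the position from its memory together with the label stored at the position
that it received, which it keeps. -/
def answerOp (f d : ℕ) [NeZero d] :
    ServerOp (Memory f d × Fin f) (Memory f d × Answer f d) (Memory f d) Prod.fst :=
  ServerOp.ofInjective _ (fun x => ((x.1.1, x.2), (x.1.2, x.1.1 x.2))) fun x x' h => by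
    simp only [Prod.mk.injEq] at h
    exact Prod.ext (Prod.ext h.1.1 h.2.1) h.1.2

/-- The protocol. The server teleports all messages and keeps the correction labels, rotated by a
uniformly random `s`. It sends `s` to the user, who returns the position `s + k`, and then it sends
the label stored there. -/
noncomputable def rotationProtocol (f d : ℕ) [NeZero f] [NeZero d] : Protocol f d where
  -- Both rounds use the same operations. The first query is the dummy position `-k + k = 0`; its
  -- purpose is to fetch `s`.
  rounds := 2
  E := Share f d
  Q _ := Fin f
  A _ := Answer f d
  S _ := Memory f d
  T _ := Share f d
  serverPrep := teleportOp f d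
  userPrep := prepChannel d
  userOp k _ := queryChannel d k
  serverOp _ := answerOp f d
  decode k := Channel.ofKraus (decodeKraus k) (decodeKraus_sum k)

end Protocol
section Protocol

variable {f d : ℕ} [NeZero f] [NeZero d]

/-! ### Evolution of the joint state -/

/-- The user's systems after the teleportation: message `l` is encrypted with the Weyl operator
whose label is stored at position `l + s`. -/
noncomputable def cipher {f d : ℕ} [NeZero d] (ψ : Fin f → EuclideanSpace ℂ (Fin d))
    (m : Fin f → ZMod d × Fin d) (s : Fin f) : Matrix (Share f d) (Share f d) ℂ :=
  Matrix.of fun e e' => ∏ l, ((weyl (m (l + s))).mulVec (ψ l).ofLp (e l) *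
    star ((weyl (m (l + s))).mulVec (ψ l).ofLp (e' l)))

/-- Measuring the whole memory kills the off-diagonal blocks. The weight, the same for all outcomes,
combines `f * d ^ f` from the isometry with `d ^ f` from the entangled state. -/
theorem mapLeft_teleport (ψ : Fin f → EuclideanSpace ℂ (Fin d)) :
    mapLeft (Share f d) (teleportOp f d).toLin
      (Matrix.of fun p q : (Share f d × Share f d) × Share f d =>
        messageState ψ p.1.1 q.1.1 * maxEntangled (Share f d) (p.1.2, p.2) (q.1.2, q.2)) =
    classicalQuantum fun x : Memory f d =>
      ((f : ℂ) * (d : ℂ) ^ (2 * f))⁻¹ • cipher ψ x.1 x.2 := by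
  ext ⟨⟨m, s⟩, e⟩ ⟨⟨m', s'⟩, e'⟩
  simp only [mapLeft, classicalQuantum, Matrix.of_apply]
  by_cases h : (m, s) = (m', s')
  · obtain ⟨rfl, rfl⟩ := Prod.mk.inj h
    have h1 : (d : ℂ) ^ (2 * f) = (d : ℂ) ^ f * (d : ℂ) ^ f := by ring
    rw [if_pos rfl]
    refine (if_pos rfl).trans ?_
    simp only [teleportOp, Matrix.mul_apply, Fintype.sum_prod_type, Matrix.of_apply, maxEntangled,
      Matrix.conjTranspose_apply, Matrix.smul_apply, smul_eq_mul, ite_and, mul_ite, ite_mul,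
      mul_zero, zero_mul, Finset.sum_ite_eq', Finset.mem_univ, if_true,
      Finset.sum_ite_irrel, Finset.sum_const_zero]
    have hc := star_mul_self_normalization f d
    simp only [teleport, Matrix.of_apply, messageState, pureState, star_mul']
    set c : ℂ := ((√((f : ℝ) * (d : ℝ) ^ f) : ℝ) : ℂ)⁻¹
    have h2 : cipher ψ m s e e' = ∑ x : Fin f → Fin d, ∑ x' : Fin f → Fin d,
        ∏ l, (weyl (m (l + s)) (e l) (x l) * ψ l (x l) *
          (star (weyl (m (l + s)) (e' l) (x' l)) * star (ψ l (x' l)))) := by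
      rw [sum_sum_prod (fun l a b => weyl (m (l + s)) (e l) a * ψ l a *
          (star (weyl (m (l + s)) (e' l) b) * star (ψ l b)))]
      simp only [cipher, Matrix.of_apply]
      refine Finset.prod_congr rfl fun l _ => ?_
      simp only [Matrix.mulVec, dotProduct, star_sum, star_mul', Finset.sum_mul_sum]
    rw [h2, h1, ← mul_assoc, mul_inv, ← hc, Finset.mul_sum]
    simp_rw [Finset.sum_mul]
    rw [Finset.sum_comm]
    refine Finset.sum_congr rfl fun x _ => ?_
    rw [Finset.mul_sum]
    refine Finset.sum_congr rfl fun x' _ => ?_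
    simp only [Finset.prod_mul_distrib, star_prod, Fintype.card_pi, Fintype.card_fin,
      Finset.prod_const, Finset.card_univ, Nat.cast_pow]
    ring
  · rw [if_neg h]
    exact if_neg h

theorem mapRight_prepChannel (k : Fin f)
    (G : Memory f d → Matrix (Share f d) (Share f d) ℂ) :
    mapRight (Memory f d) (prepChannel d k).toLin (classicalQuantum G) =
    Matrix.reindex (Equiv.prodAssoc _ _ _) (Equiv.prodAssoc _ _ _)
      (classicalQuantum fun x : Memory f d × Answer f d =>
        if x.2 = (-k, 0) then G x.1 else 0) := by
  ext ⟨x, a, e⟩ ⟨x', a', e'⟩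
  refine (Channel.relabel_toLin_apply
    (fun e : Share f d => (((-k, 0), e) : Answer f d × Share f d)) (fun _ => ())
    (prep_injective k) _ _ _).trans ?_
  simp only [classicalQuantum, Matrix.of_apply,
    Matrix.reindex_apply, Matrix.submatrix_apply, Equiv.prodAssoc_symm_apply, Prod.mk.injEq]
  rw [Finset.sum_eq_single e, Finset.sum_eq_single e']
  · by_cases hx : x = x' <;> by_cases ha : a = (-k, 0) <;> by_cases ha' : a' = (-k, 0) <;>
      simp [hx, ha, ha', eq_comm]
  · intro t _ ht; simp [ht.symm]
  · simp
  · intro t _ ht; simp [ht.symm]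
  · simp

theorem mapRight_queryChannel (k : Fin f)
    (G : Memory f d × Answer f d → Matrix (Share f d) (Share f d) ℂ) :
    Matrix.reindex (Equiv.prodAssoc _ _ _).symm (Equiv.prodAssoc _ _ _).symm
      (mapRight (Memory f d) (queryChannel d k).toLin (Matrix.reindex (Equiv.prodAssoc _ _ _)
      (Equiv.prodAssoc _ _ _) (classicalQuantum G))) =
    classicalQuantum fun y : Memory f d × Fin f => ∑ v, G (y.1, (y.2 - k, v)) := by
  refine (mapRight_relabel_classicalQuantum (fun a : Answer f d => a.1 + k)
    (fun a => a.2) _ G).trans ?_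
  congr 1
  funext y
  rw [Fintype.sum_prod_type, Finset.sum_eq_single (y.2 - k)]
  · simp
  · intro s _ hs
    have : y.2 ≠ s + k := fun h => hs (by rw [h, add_sub_cancel_right])
    simp [this]
  · simp

/-- The two positions change places: the stored one leaves with the answer and the received one
stays. -/
theorem mapLeft_answerOp {f d : ℕ} [NeZero d]
    (G : Memory f d × Fin f → Matrix (Share f d) (Share f d) ℂ) :
    mapLeft (Share f d) (answerOp f d).toLin (classicalQuantum G) =
      classicalQuantum fun y : Memory f d × Answer f d =>
        if y.2.2 = y.1.1 y.1.2 then G ((y.1.1, y.2.1), y.1.2) else 0 := by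
  refine (mapLeft_ofInjective_classicalQuantum _ _ _ G).trans ?_
  congr 1
  funext ⟨⟨m, j⟩, ⟨s, v⟩⟩
  rw [Finset.sum_eq_single ((m, s), j)]
  · simp
  · rintro ⟨⟨m', s'⟩, j'⟩ _ hne
    refine if_neg fun h => hne ?_
    simp only [Prod.mk.injEq] at h ⊢
    exact ⟨⟨h.1.1.symm, h.2.1.symm⟩, h.1.2.symm⟩
  · simp

theorem queryStep_zero (ψ : Fin f → EuclideanSpace ℂ (Fin d)) (k : Fin f) :
    (rotationProtocol f d).queryStep k 0 ((rotationProtocol f d).stateAfter ψ k 0) =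
    classicalQuantum fun y : Memory f d × Fin f =>
      if y.2 = 0 then ((f : ℂ) * (d : ℂ) ^ (2 * f))⁻¹ • cipher ψ y.1.1 y.1.2 else 0 := by
  have h := mapRight_prepChannel k
    (fun x : Memory f d => ((f : ℂ) * (d : ℂ) ^ (2 * f))⁻¹ • cipher ψ x.1 x.2)
  rw [← mapLeft_teleport ψ] at h
  refine (congrArg (fun M => Matrix.reindex (Equiv.prodAssoc _ _ _).symm
    (Equiv.prodAssoc _ _ _).symm (mapRight (Memory f d) (queryChannel d k).toLin M)) h).trans ?_
  refine (mapRight_queryChannel k _).trans ?_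
  congr 1
  funext y
  simp [ite_and, sub_eq_iff_eq_add]

/-- The memory now holds the dummy position 0 in place of `s`. The query `y.2` is `s + k`, hence the
rotation `y.2 - k`; the label from the first answer has been discarded. -/
theorem queryStep_one (ψ : Fin f → EuclideanSpace ℂ (Fin d)) (k : Fin f) :
    (rotationProtocol f d).queryStep k 1 ((rotationProtocol f d).stateAfter ψ k 1) =
    classicalQuantum fun y : Memory f d × Fin f =>
      if y.1.2 = 0 then ((f : ℂ) * (d : ℂ) ^ (2 * f))⁻¹ • cipher ψ y.1.1 (y.2 - k) else 0 := by
  have h := (congrArg (mapLeft (Share f d) (answerOp f d).toLin) (queryStep_zero ψ k)).trans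
    (mapLeft_answerOp _)
  refine (congrArg (fun M => Matrix.reindex (Equiv.prodAssoc _ _ _).symm
    (Equiv.prodAssoc _ _ _).symm (mapRight (Memory f d) (queryChannel d k).toLin
      (Matrix.reindex (Equiv.prodAssoc _ _ _) (Equiv.prodAssoc _ _ _) M))) h).trans ?_
  refine (mapRight_queryChannel k _).trans ?_
  congr 1
  funext y
  simp

theorem stateAfter_two (ψ : Fin f → EuclideanSpace ℂ (Fin d)) (k : Fin f) :
    (rotationProtocol f d).stateAfter ψ k 2 =
    Matrix.reindex (Equiv.prodAssoc (Memory f d) (Answer f d) (Share f d))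
      (Equiv.prodAssoc (Memory f d) (Answer f d) (Share f d))
      (classicalQuantum fun y : Memory f d × Answer f d =>
        if y.2.2 = y.1.1 y.1.2 then
          if y.2.1 = 0 then ((f : ℂ) * (d : ℂ) ^ (2 * f))⁻¹ • cipher ψ y.1.1 (y.1.2 - k) else 0
        else 0) :=
  congrArg (Matrix.reindex (Equiv.prodAssoc _ _ _) (Equiv.prodAssoc _ _ _))
    ((congrArg (mapLeft (Share f d) (answerOp f d).toLin) (queryStep_one ψ k)).trans
      (mapLeft_answerOp _))

/-! ### Secrecy -/

theorem sum_weyl_mulVec {ψ : EuclideanSpace ℂ (Fin d)} (hψ : ‖ψ‖ = 1) (u : ZMod d × Fin d) :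
    ∑ a, (weyl u).mulVec ψ.ofLp a * star ((weyl u).mulVec ψ.ofLp a) = 1 := by
  change (weyl u).mulVec ψ.ofLp ⬝ᵥ star ((weyl u).mulVec ψ.ofLp) = 1
  rw [dotProduct_comm, Matrix.star_mulVec, ← Matrix.dotProduct_mulVec, Matrix.mulVec_mulVec,
    weyl_unitary, Matrix.one_mulVec, dotProduct_comm, ← EuclideanSpace.inner_eq_star_dotProduct,
    inner_self_eq_norm_sq_to_K, hψ]
  simp

theorem trace_cipher {f : ℕ} {ψ : Fin f → EuclideanSpace ℂ (Fin d)} (hψ : ∀ l, ‖ψ l‖ = 1)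
    (m : Fin f → ZMod d × Fin d) (s : Fin f) : (cipher ψ m s).trace = 1 := by
  simp only [Matrix.trace, Matrix.diag_apply, cipher, Matrix.of_apply]
  rw [← Fintype.prod_sum (fun l a => (weyl (m (l + s))).mulVec (ψ l).ofLp a *
    star ((weyl (m (l + s))).mulVec (ψ l).ofLp a))]
  exact Finset.prod_eq_one fun l _ => sum_weyl_mulVec (hψ l) _

theorem traceRight_classicalQuantum {X τ : Type} [Fintype τ] [DecidableEq X]
    (G : X → Matrix τ τ ℂ) :
    traceRight (classicalQuantum G) = Matrix.diagonal fun x => (G x).trace := by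
  ext x x'
  by_cases h : x = x' <;> simp [traceRight, classicalQuantum, h, Matrix.trace]

/-- The choice `k` only shifts the rotation inside the encrypted state, whose trace is one for every
rotation; the server sees uniform labels and a uniform position. -/
theorem traceRight_query {ψ : Fin f → EuclideanSpace ℂ (Fin d)} (hψ : ∀ l, ‖ψ l‖ = 1)
    (k : Fin f) :
    traceRight (classicalQuantum fun y : Memory f d × Fin f =>
      if y.1.2 = 0 then ((f : ℂ) * (d : ℂ) ^ (2 * f))⁻¹ • cipher ψ y.1.1 (y.2 - k) else 0) =
    Matrix.diagonal fun y => if y.1.2 = 0 then ((f : ℂ) * (d : ℂ) ^ (2 * f))⁻¹ else 0 := by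
  rw [traceRight_classicalQuantum]
  congr 1
  funext y
  split_ifs <;> simp [Matrix.trace_smul, trace_cipher hψ]

theorem rotationProtocol_isAllRoundSecret : (rotationProtocol f d).IsAllRoundSecret := by
  intro ψ hψ i hi k k'
  have hi : i < 2 := hi
  interval_cases i
  · exact congrArg traceRight ((queryStep_zero ψ k).trans (queryStep_zero ψ k').symm)
  · refine (congrArg traceRight (queryStep_one ψ k)).trans
      (Eq.trans ?_ (congrArg traceRight (queryStep_one ψ k')).symm)
    exact (traceRight_query hψ k).trans (traceRight_query hψ k').symm

/-! ### Decoding and correctness -/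

theorem traceLeft_classicalQuantum {X A τ : Type} [Fintype X] [DecidableEq X] [DecidableEq A]
    (G : X × A → Matrix τ τ ℂ) :
    traceLeft (Matrix.reindex (Equiv.prodAssoc X A τ) (Equiv.prodAssoc X A τ)
      (classicalQuantum G)) = classicalQuantum fun a => ∑ x, G (x, a) := by
  ext ⟨a, e⟩ ⟨a', e'⟩
  by_cases h : a = a' <;> simp [traceLeft, classicalQuantum, h, Matrix.sum_apply]

theorem decode_classicalQuantum {f d : ℕ} [NeZero d] (k : Fin f)
    (H : Answer f d → Matrix (Share f d) (Share f d) ℂ)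
    (x x' : Fin d) :
    (Channel.ofKraus (decodeKraus k) (decodeKraus_sum k)).toLin (classicalQuantum H) x x' =
      ∑ a, ∑ e, ∑ e', if Function.update e k 0 = Function.update e' k 0 then
        star (weyl a.2 (e k) x) * H a e e' * weyl a.2 (e' k) x' else 0 := by
  rw [Channel.ofKraus_toLin_apply, Finset.sum_comm, Fintype.sum_prod_type]
  refine Finset.sum_congr rfl fun a _ => Finset.sum_congr rfl fun e _ => ?_
  rw [Finset.sum_eq_single (a, Function.update e k 0)]
  · rw [Fintype.sum_prod_type, Finset.sum_eq_single a]
    · refine Finset.sum_congr rfl fun e' _ => ?_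
      by_cases h : Function.update e k 0 = Function.update e' k 0
      · simp [decodeKraus, classicalQuantum, h]
      · simp [decodeKraus, h, Ne.symm h]
    · intro a' _ ha
      simp [classicalQuantum, ha.symm]
    · simp
  · intro c _ hc
    have : ¬ (a = c.1 ∧ Function.update e k 0 = c.2) := fun h => hc (Prod.ext h.1.symm h.2.symm)
    simp [decodeKraus, this]
  · simp

theorem update_eq_update_iff {f d : ℕ} [NeZero d] (k : Fin f) (e e' : Share f d) :
    Function.update e k 0 = Function.update e' k 0 ↔ ∀ l, l ≠ k → e l = e' l := by
  refine ⟨fun h l hl => by simpa [hl] using congrFun h l, fun h => funext fun l => ?_⟩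
  by_cases hl : l = k
  · simp [hl]
  · simp [hl, h l hl]

theorem sum_star_weyl_mul_mulVec (u : ZMod d × Fin d) (v : Fin d → ℂ) (x : Fin d) :
    ∑ a, star (weyl u a x) * (weyl u).mulVec v a = v x := by
  have h := congrFun (Matrix.mulVec_mulVec v (weyl u).conjTranspose (weyl u)) x
  rw [weyl_unitary, Matrix.one_mulVec] at h
  exact h

/-- Since `k + (j - k) = j`, the label at position `j` is the one that encrypts message `k`. Undoing
it restores that message; the other registers are traced out and contribute 1 each. -/
theorem decode_cipher {ψ : Fin f → EuclideanSpace ℂ (Fin d)} (hψ : ∀ l, ‖ψ l‖ = 1) (k : Fin f)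
    (m : Fin f → ZMod d × Fin d) (j : Fin f) (x x' : Fin d) :
    (∑ e, ∑ e', if Function.update e k 0 = Function.update e' k 0 then
      star (weyl (m j) (e k) x) * cipher ψ m (j - k) e e' * weyl (m j) (e' k) x' else 0) =
      pureState (ψ k) x x' := by
  -- The local factor at site `l`: decoding at `k`, and elsewhere the Kronecker delta of a partial
  -- trace.
  set h : Fin f → Fin d → Fin d → ℂ := fun l a b =>
    (if l = k then star (weyl (m j) a x) * weyl (m j) b x' else if a = b then 1 else 0) *
      ((weyl (m (l + (j - k)))).mulVec (ψ l).ofLp a *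
        star ((weyl (m (l + (j - k)))).mulVec (ψ l).ofLp b)) with hdef
  have hprod : ∀ e e' : Share f d, (if Function.update e k 0 = Function.update e' k 0 then
      star (weyl (m j) (e k) x) * cipher ψ m (j - k) e e' * weyl (m j) (e' k) x' else 0) =
      ∏ l, h l (e l) (e' l) := by
    intro e e'
    simp only [hdef, Finset.prod_mul_distrib, update_eq_update_iff]
    split_ifs with hE
    · rw [Finset.prod_eq_single k (fun l _ hl => by simp [hl, hE l hl]) (by simp), if_pos rfl,
        ← Finset.prod_mul_distrib]
      simp only [cipher, Matrix.of_apply]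
      ring
    · push Not at hE
      obtain ⟨l, hl, hne⟩ := hE
      rw [Finset.prod_eq_zero (Finset.mem_univ l) (by simp [hl, hne]), zero_mul]
  simp_rw [hprod]
  rw [sum_sum_prod, Finset.prod_eq_single k]
  · have hk : k + (j - k) = j := by abel
    have e1 : star (∑ b, star (weyl (m j) b x') * (weyl (m j)).mulVec (ψ k).ofLp b) =
        star (ψ k x') := by rw [sum_star_weyl_mul_mulVec]
    simp only [hdef, if_true, hk, pureState, Matrix.of_apply]
    rw [← e1, ← sum_star_weyl_mul_mulVec (m j) (ψ k).ofLp x, star_sum, Finset.sum_mul_sum]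
    refine Finset.sum_congr rfl fun a _ => Finset.sum_congr rfl fun b _ => ?_
    rw [star_mul', star_star]
    ring
  · intro l _ hl
    rw [← sum_weyl_mulVec (hψ l) (m (l + (j - k)))]
    refine Finset.sum_congr rfl fun a _ => ?_
    simp [hdef, hl]
  · simp

/-- Each memory content is compatible with exactly one answer and yields the same multiple of the
wanted state; there are `f * d ^ (2 * f)` contents, which cancels the weight. -/
theorem decode_sum_cipher {ψ : Fin f → EuclideanSpace ℂ (Fin d)} (hψ : ∀ l, ‖ψ l‖ = 1)
    (k : Fin f) :
    (Channel.ofKraus (decodeKraus k) (decodeKraus_sum k)).toLin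
      (classicalQuantum fun a : Answer f d => ∑ y : Memory f d, if a.2 = y.1 y.2 then
        if a.1 = 0 then ((f : ℂ) * (d : ℂ) ^ (2 * f))⁻¹ • cipher ψ y.1 (y.2 - k) else 0 else 0) =
      pureState (ψ k) := by
  have hf : (f : ℂ) ≠ 0 := Nat.cast_ne_zero.2 (NeZero.ne f)
  have hd : (d : ℂ) ≠ 0 := Nat.cast_ne_zero.2 (NeZero.ne d)
  ext x x'
  rw [decode_classicalQuantum]
  set C : ℂ := ((f : ℂ) * (d : ℂ) ^ (2 * f))⁻¹ with hC
  have hterm : ∀ a : Answer f d, (∑ e, ∑ e', if Function.update e k 0 = Function.update e' k 0 then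
      star (weyl a.2 (e k) x) * (∑ y : Memory f d, if a.2 = y.1 y.2 then
        if a.1 = 0 then C • cipher ψ y.1 (y.2 - k) else 0 else 0 :
          Matrix (Share f d) (Share f d) ℂ) e e' * weyl a.2 (e' k) x' else 0) =
      ∑ y : Memory f d, if a = (0, y.1 y.2) then C * pureState (ψ k) x x' else 0 := by
    intro a
    have hpush : ∀ e e' : Share f d, (if Function.update e k 0 = Function.update e' k 0 then
        star (weyl a.2 (e k) x) * (∑ y : Memory f d, if a.2 = y.1 y.2 then
          if a.1 = 0 then C • cipher ψ y.1 (y.2 - k) else 0 else 0 :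
            Matrix (Share f d) (Share f d) ℂ) e e' * weyl a.2 (e' k) x' else 0) =
        ∑ y : Memory f d, if a = (0, y.1 y.2) then C *
          (if Function.update e k 0 = Function.update e' k 0 then
            star (weyl (y.1 y.2) (e k) x) * cipher ψ y.1 (y.2 - k) e e' *
              weyl (y.1 y.2) (e' k) x' else 0) else 0 := by
      intro e e'
      by_cases hU : Function.update e k 0 = Function.update e' k 0
      · simp only [hU, if_true, Matrix.sum_apply, Finset.mul_sum, Finset.sum_mul]
        refine Finset.sum_congr rfl fun y _ => ?_
        obtain ⟨a1, a2⟩ := a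
        by_cases h2 : a2 = y.1 y.2 <;> by_cases h1 : a1 = 0 <;> simp [h1, h2]
        ring
      · simp [hU]
    simp_rw [hpush]
    refine ((Finset.sum_congr rfl fun e _ => Finset.sum_comm).trans Finset.sum_comm).trans ?_
    refine Finset.sum_congr rfl fun y _ => ?_
    split_ifs
    · simp_rw [← Finset.mul_sum]
      rw [decode_cipher hψ]
    · simp
  refine (Finset.sum_congr rfl fun a _ => hterm a).trans ?_
  rw [Finset.sum_comm]
  simp only [Finset.sum_ite_eq', Finset.mem_univ, if_true, Finset.sum_const, Finset.card_univ,
    Fintype.card_prod, Fintype.card_pi, ZMod.card, Fintype.card_fin, Finset.prod_const,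
    nsmul_eq_mul]
  rw [hC]
  push_cast
  field_simp
  rw [pow_mul]

theorem rotationProtocol_isCorrect : (rotationProtocol f d).IsCorrect := fun ψ hψ k =>
  (congrArg (Channel.ofKraus (decodeKraus k) (decodeKraus_sum k)).toLin
    ((congrArg traceLeft (stateAfter_two ψ k)).trans (traceLeft_classicalQuantum _))).trans
      (decode_sum_cipher hψ k)

/-! ### The case of no messages, and the cost -/

/-- The protocol without any message. -/
def emptyProtocol (d : ℕ) : Protocol 0 d where
  rounds := 0
  E := Unit
  Q _ := Unit
  A _ := Unit
  S _ := Unit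
  T _ := Unit
  serverPrep := ServerOp.ofInjective _ (fun _ => ()) (Function.injective_of_subsingleton _)
  userPrep k := k.elim0
  userOp k := k.elim0
  serverOp _ := ServerOp.ofInjective _ (fun _ => ((), ())) (Function.injective_of_subsingleton _)
  decode k := k.elim0

theorem rotationProtocol_communicationComplexity :
    (rotationProtocol f d).communicationComplexity = 4 * Real.logb 2 f + 4 * Real.logb 2 d := by
  have hf : (f : ℝ) ≠ 0 := Nat.cast_ne_zero.2 (NeZero.ne f)
  have hd : (d : ℝ) ≠ 0 := Nat.cast_ne_zero.2 (NeZero.ne d)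
  have hQ : (rotationProtocol f d).uploadComplexity =
      ∑ i ∈ Finset.range 2, Real.logb 2 (Fintype.card (Fin f)) := rfl
  have hA : (rotationProtocol f d).downloadComplexity =
      ∑ i ∈ Finset.range 2, Real.logb 2 (Fintype.card (Answer f d)) := rfl
  rw [Protocol.communicationComplexity, hQ, hA]
  simp only [Finset.sum_const, Finset.card_range, Fintype.card_prod, Fintype.card_fin, ZMod.card,
    Nat.cast_mul, nsmul_eq_mul, Real.logb_mul hf (mul_ne_zero hd hd), Real.logb_mul hd hd]
  push_cast
  ring

theorem rotationProtocol_ebits : (rotationProtocol f d).ebits = messageSize f d := by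
  have hE : (rotationProtocol f d).ebits = Real.logb 2 (Fintype.card (Share f d)) := rfl
  rw [hE, messageSize]
  simp [Real.logb_pow]

end Protocol
end QPIR

theorem corollary3 (d : ℕ) (hd : 2 ≤ d) :
    ∃ Φ : (f : ℕ) → QPIR.Protocol f d,
      (∀ f, (Φ f).IsCorrect) ∧
      (∀ f, (Φ f).IsAllRoundSecret) ∧
      (fun f => (Φ f).communicationComplexity) =O[Filter.atTop]
        (fun f => Real.logb 2 (QPIR.messageSize f d)) ∧
      (fun f => (Φ f).ebits) =Θ[Filter.atTop] (fun f => QPIR.messageSize f d) := by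
  have : NeZero d := ⟨by omega⟩
  refine ⟨fun f => match f with
    -- With no messages there is no cyclic group of positions, so this case is separate.
    | 0 => QPIR.emptyProtocol d
    | f + 1 => QPIR.rotationProtocol (f + 1) d, ?_, ?_, ?_, ?_⟩
  · rintro (_ | f)
    · exact fun _ _ k => k.elim0
    · exact QPIR.rotationProtocol_isCorrect
  · rintro (_ | f)
    · exact fun _ _ _ _ k => k.elim0
    · exact QPIR.rotationProtocol_isAllRoundSecret
  -- The cost is `4 log f + 4 log d`; once `f ≥ d`, both logarithms are at most that of the message
  -- size, whence `8 = 4 + 4`.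
  · refine Asymptotics.IsBigO.of_bound 8 ?_
    filter_upwards [Filter.eventually_ge_atTop d] with f hf
    obtain _ | f := f
    · omega
    have hd2 : (2 : ℝ) ≤ d := by exact_mod_cast hd
    have hfd : (d : ℝ) ≤ (f + 1 : ℕ) := by exact_mod_cast hf
    have h1 : 1 ≤ Real.logb 2 d := by
      rw [Real.le_logb_iff_rpow_le one_lt_two (by linarith), Real.rpow_one]
      exact hd2
    have h2 : Real.logb 2 d ≤ Real.logb 2 (f + 1 : ℕ) :=
      Real.logb_le_logb_of_le one_lt_two (by linarith) hfd
    have h3 : Real.logb 2 (f + 1 : ℕ) ≤ Real.logb 2 (QPIR.messageSize (f + 1) d) :=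
      Real.logb_le_logb_of_le one_lt_two (by linarith)
        (le_mul_of_one_le_right (Nat.cast_nonneg _) h1)
    dsimp only
    rw [QPIR.rotationProtocol_communicationComplexity, Real.norm_of_nonneg (by linarith),
      Real.norm_of_nonneg (by linarith)]
    linarith
  · refine Filter.EventuallyEq.isTheta ?_
    filter_upwards [Filter.eventually_ge_atTop 1] with f hf
    obtain _ | f := f
    · omega
    · exact QPIR.rotationProtocol_ebits
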